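/- Let $H$ be a complex Hilbert space with $\dim H\ge 2$, and let $E(H)$ be the set of all effects on $H$, i.e. the bounded linear operators $A$ on $H$ with $0\le A\le I$, with the usual order of self-adjoint operators. A sequential automorphism of $E(H)$ is a bijection $\phi:E(H)\to E(H)$ such that $$\phi(\sqrt{A}\,B\sqrt{A})=\sqrt{\phi(A)}\,\phi(B)\sqrt{\phi(A)}\qquad(A,B\in E(H)).$$ Let $\phi:E(H)\to E(H)$ be a sequential automorphism. Then $\phi$ preserves the order and zero product in both directions, that is, for all $A,B\in E(H)$, $$A\le B\iff\phi(A)\le\phi(B)\qquad\text{and}\qquad AB=0\iff\phi(A)\phi(B)=0 .$$ In fact, there is an either unitary or antiunitary operator $U$ on $H$ (antiunitary: a bijective conjugate-linear isometry) such that $$\phi(A)=UAU^*\qquad(A\in E(H)).$$ -/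

import Mathlib

namespace HilbertEffects

section Effects

variable {H : Type*} [NormedAddCommGroup H] [InnerProductSpace ℂ H] [CompleteSpace H]

/-- The set `E(H)` of effects: the bounded operators `A` on `H` with `0 ≤ A ≤ I` in the usual
(Loewner) order. As a type it carries the order inherited from the operators. -/
abbrev Effects (H : Type*) [NormedAddCommGroup H] [InnerProductSpace ℂ H] [CompleteSpace H] :
    Set (H →L[ℂ] H) :=
  Set.Icc 0 1

theorem seqProd_mem (A B : Effects H) :
    CFC.sqrt (A : H →L[ℂ] H) * B * CFC.sqrt (A : H →L[ℂ] H) ∈ Effects H := by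
  have hs : IsSelfAdjoint (CFC.sqrt (A : H →L[ℂ] H)) :=
    IsSelfAdjoint.of_nonneg (CFC.sqrt_nonneg _)
  refine ⟨hs.conjugate_nonneg B.2.1, ?_⟩
  have h := hs.conjugate_le_conjugate B.2.2
  rw [mul_one, CFC.sqrt_mul_sqrt_self _ A.2.1] at h
  exact h.trans A.2.2

/-- The sequential product `A ∘ B = √A B √A` of two effects, again an effect. -/
noncomputable def seqProd (A B : Effects H) : Effects H :=
  ⟨CFC.sqrt (A : H →L[ℂ] H) * B * CFC.sqrt (A : H →L[ℂ] H), seqProd_mem A B⟩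

/-- A sequential automorphism: a bijection of `E(H)` that respects the sequential product. -/
def IsSequentialAutomorphism (φ : Effects H → Effects H) : Prop :=
  Function.Bijective φ ∧ ∀ A B : Effects H, φ (seqProd A B) = seqProd (φ A) (φ B)

/-- `φ` preserves the order in both directions. -/
def PreservesOrder (φ : Effects H → Effects H) : Prop :=
  ∀ A B : Effects H, A ≤ B ↔ φ A ≤ φ B

/-- `φ` preserves zero product in both directions. -/
def PreservesZeroProduct (φ : Effects H → Effects H) : Prop :=
  ∀ A B : Effects H,
    (A : H →L[ℂ] H) * (B : H →L[ℂ] H) = 0 ↔ (φ A : H →L[ℂ] H) * (φ B : H →L[ℂ] H) = 0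

end Effects

section Antiunitary

open scoped InnerProductSpace

variable {H : Type*} [NormedAddCommGroup H] [InnerProductSpace ℂ H]

/-- The type of antiunitary operators on `H`: bijective conjugate-linear isometries. -/
abbrev Antiunitary (H : Type*) [NormedAddCommGroup H] [InnerProductSpace ℂ H] : Type _ :=
  H ≃ₛₗᵢ[starRingEnd ℂ] H

/-- The adjoint `U*` of an antiunitary operator `U`, which is its inverse; the defining relation
of the adjoint is `Antiunitary.inner_adjoint`. -/
def Antiunitary.adjoint (U : Antiunitary H) : Antiunitary H := LinearIsometryEquiv.symm U

/-- The defining relation `⟪U x, y⟫ = conj ⟪x, U* y⟫` of the adjoint of a conjugate-linear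
operator. -/
theorem Antiunitary.inner_adjoint (U : Antiunitary H) (x y : H) :
    ⟪U x, y⟫_ℂ = starRingEnd ℂ ⟪x, Antiunitary.adjoint U y⟫_ℂ := by
  obtain ⟨z, rfl⟩ := LinearIsometryEquiv.surjective U y
  have hI : ∀ w : H, U (Complex.I • w) = -(Complex.I • U w) := by
    intro w
    rw [LinearIsometryEquiv.map_smulₛₗ]
    simp
  have h : Antiunitary.adjoint U (U z) = z := LinearIsometryEquiv.symm_apply_apply U z
  have hn : ∀ w : H, ‖w‖ = ‖Complex.I • w‖ := fun w => by simp [norm_smul]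
  have h1 : ‖U x + U z‖ = ‖z + x‖ := by
    rw [← map_add, LinearIsometryEquiv.norm_map, add_comm]
  have h2 : ‖U x - U z‖ = ‖z - x‖ := by
    rw [← map_sub, LinearIsometryEquiv.norm_map, norm_sub_rev]
  have h3 : ‖U x - Complex.I • U z‖ = ‖z - Complex.I • x‖ := by
    rw [sub_eq_add_neg, ← hI, ← map_add, LinearIsometryEquiv.norm_map, hn, smul_add, smul_smul,
      Complex.I_mul_I, neg_one_smul, ← norm_neg]
    congr 1; abel
  have h4 : ‖U x + Complex.I • U z‖ = ‖z + Complex.I • x‖ := by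
    have e : U x + Complex.I • U z = U (x - Complex.I • z) := by rw [map_sub, hI, sub_neg_eq_add]
    rw [e, LinearIsometryEquiv.norm_map, hn, smul_sub, smul_smul,
      Complex.I_mul_I, neg_one_smul, sub_neg_eq_add, add_comm]
  rw [h, inner_conj_symm, inner_eq_sum_norm_sq_div_four, inner_eq_sum_norm_sq_div_four z x]
  simp only [RCLike.I_to_complex, h1, h2, h3, h4]

/-- The operator `U A U*` for an antiunitary `U`; it is again complex-linear. -/
def Antiunitary.conj (U : Antiunitary H) (A : H →L[ℂ] H) : H →L[ℂ] H :=
  (U.toContinuousLinearEquiv : H →SL[starRingEnd ℂ] H).comp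
    (A.comp ((Antiunitary.adjoint U).toContinuousLinearEquiv : H →SL[starRingEnd ℂ] H))

theorem Antiunitary.conj_apply (U : Antiunitary H) (A : H →L[ℂ] H) (x : H) :
    Antiunitary.conj U A x = U (A (Antiunitary.adjoint U x)) := rfl

end Antiunitary

end HilbertEffects

/-! Everything is read off from rank-one projections. For a unit vector `x` with line projection
`P_x`, the sequential product `P_x ∘ A` is `⟪x, A x⟫ P_x`. Projections are the `∘`-idempotents, so
`φ` permutes them, and it permutes the rank-one ones by minimality (`exists_map_lineProj`). Scalars
are the `∘`-central effects, so `φ (t A) = f t φ A` for a multiplicative `f` (`exists_map_smul`).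
Hence `φ P_x = P_y` gives `⟪y, φ(A) y⟫ = f ⟪x, A x⟫`. Since `φ` respects complements of projections,
and in dimension at least 2 every `t` in the unit interval is the expectation of a projection, `f t
+ f (1 - t) = 1`. This forces `f = id`: `φ` preserves expectations (`expectation_map`).

What remains is a Wigner-type argument. Fix `φ P_e = P_e'`. A line not orthogonal to `e` contains a
unique `e + v` with `v ⊥ e`, so `φ` induces a map `V` by `e + v ↦ e' + V v`. Transition
probabilities give `|1 + ⟪V v, V w⟫| = |1 + ⟪v, w⟫|`, and midpoints of projections give equality of
real parts (`re_inner_lift`). So `V` is linear or conjugate-linear and extends to `U`; polarizing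
expectations yields `φ(A) U = U A`. -/

open scoped InnerProductSpace

namespace HilbertEffects

/-! ### Quadratic forms of operators -/

section Expectation

variable {H : Type*} [NormedAddCommGroup H] [InnerProductSpace ℂ H]

/-- The expectation of the operator `A` in the vector `x`. -/
noncomputable def expectation (A : H →L[ℂ] H) (x : H) : ℝ := (⟪x, A x⟫_ℂ).re

theorem expectation_mono {A B : H →L[ℂ] H} (h : A ≤ B) (x : H) :
    expectation A x ≤ expectation B x := by
  have h := ((ContinuousLinearMap.le_def _ _).1 h).re_inner_nonneg_right x
  simpa [expectation, inner_sub_right] using h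

theorem expectation_one (x : H) : expectation (1 : H →L[ℂ] H) x = ‖x‖ ^ 2 := by
  simp [expectation, inner_self_eq_norm_sq_to_K, ← Complex.ofReal_pow]

theorem expectation_smul (A : H →L[ℂ] H) (c : ℂ) (x : H) :
    expectation A (c • x) = ‖c‖ ^ 2 * expectation A x := by
  rw [expectation, map_smul, inner_smul_left, inner_smul_right, ← mul_assoc, mul_comm _ c,
    Complex.mul_conj, Complex.normSq_eq_norm_sq, Complex.re_ofReal_mul, expectation]

end Expectation

/-! ### Effects, projections and the sequential product -/

section SequentialProduct

variable {H : Type*} [NormedAddCommGroup H] [InnerProductSpace ℂ H] [CompleteSpace H]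

theorem seqProd_coe (A B : Effects H) : (seqProd A B : H →L[ℂ] H) =
    CFC.sqrt (A : H →L[ℂ] H) * B * CFC.sqrt (A : H →L[ℂ] H) := rfl

theorem Effects.isSelfAdjoint (A : Effects H) : IsSelfAdjoint (A : H →L[ℂ] H) :=
  IsSelfAdjoint.of_nonneg A.2.1

/-- The zero effect. -/
def zeroEffect (H : Type*) [NormedAddCommGroup H] [InnerProductSpace ℂ H] [CompleteSpace H] :
    Effects H :=
  ⟨0, le_rfl, IsStarProjection.le_one (.zero _)⟩

/-- The identity effect. -/
def oneEffect (H : Type*) [NormedAddCommGroup H] [InnerProductSpace ℂ H] [CompleteSpace H] :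
    Effects H :=
  ⟨1, IsStarProjection.nonneg (.one _), le_rfl⟩

/-- The effect `1 - A`. -/
def complement (A : Effects H) : Effects H :=
  ⟨1 - A, sub_nonneg.2 A.2.2, sub_le_self _ A.2.1⟩

@[simp] theorem zeroEffect_coe : (zeroEffect H : H →L[ℂ] H) = 0 := rfl

@[simp] theorem oneEffect_coe : (oneEffect H : H →L[ℂ] H) = 1 := rfl

@[simp] theorem complement_coe (A : Effects H) : (complement A : H →L[ℂ] H) = 1 - A := rfl

theorem zero_seqProd (A : Effects H) : seqProd (zeroEffect H) A = zeroEffect H :=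
  Subtype.ext (by simp [seqProd_coe])

theorem seqProd_zero (A : Effects H) : seqProd A (zeroEffect H) = zeroEffect H :=
  Subtype.ext (by simp [seqProd_coe])

theorem seqProd_self_coe (A : Effects H) :
    (seqProd A A : H →L[ℂ] H) = (A : H →L[ℂ] H) * A := by
  have h := CFC.sqrt_mul_sqrt_self (A : H →L[ℂ] H) A.2.1
  rw [seqProd_coe]
  generalize CFC.sqrt (A : H →L[ℂ] H) = S at h
  rw [← h]
  simp only [mul_assoc]

/-- The effect `t A` for a real number `t` of the unit interval. -/
noncomputable def smulEffect (t : ℝ) (ht : t ∈ Set.Icc (0 : ℝ) 1) (A : Effects H) : Effects H :=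
  ⟨(t : ℂ) • (A : H →L[ℂ] H), by
    have h0 : ∀ s : ℝ, 0 ≤ s → (0 : H →L[ℂ] H) ≤ (s : ℂ) • (A : H →L[ℂ] H) := fun s hs => by
      rw [ContinuousLinearMap.nonneg_iff_isPositive]
      exact ((ContinuousLinearMap.nonneg_iff_isPositive _).1 A.2.1).smul_of_nonneg
        (Complex.zero_le_real.2 hs)
    refine ⟨h0 t ht.1, le_trans ?_ A.2.2⟩
    have h1 := h0 (1 - t) (by linarith [ht.2])
    rwa [Complex.ofReal_sub, sub_smul, Complex.ofReal_one, one_smul, sub_nonneg] at h1⟩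

@[simp] theorem smulEffect_coe (t : ℝ) (ht : t ∈ Set.Icc (0 : ℝ) 1) (A : Effects H) :
    (smulEffect t ht A : H →L[ℂ] H) = (t : ℂ) • (A : H →L[ℂ] H) := rfl

theorem seqProd_smul_one (t : ℝ) (ht : t ∈ Set.Icc (0 : ℝ) 1) (A : Effects H) :
    seqProd A (smulEffect t ht (oneEffect H)) = smulEffect t ht A :=
  Subtype.ext (by simp [seqProd_coe, CFC.sqrt_mul_sqrt_self (A : H →L[ℂ] H) A.2.1])

theorem sqrt_ofReal_smul_one {t : ℝ} (ht : 0 ≤ t) :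
    CFC.sqrt ((t : ℂ) • (1 : H →L[ℂ] H)) = ((Real.sqrt t : ℝ) : ℂ) • (1 : H →L[ℂ] H) := by
  refine CFC.sqrt_unique ?_ ?_
  · rw [smul_mul_smul_comm, mul_one, ← Complex.ofReal_mul, Real.mul_self_sqrt ht]
  · rw [ContinuousLinearMap.nonneg_iff_isPositive]
    exact ContinuousLinearMap.isPositive_one.smul_of_nonneg
      (Complex.zero_le_real.2 (Real.sqrt_nonneg t))

theorem smul_one_seqProd (t : ℝ) (ht : t ∈ Set.Icc (0 : ℝ) 1) (A : Effects H) :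
    seqProd (smulEffect t ht (oneEffect H)) A = smulEffect t ht A :=
  Subtype.ext (by
    simp only [seqProd_coe, smulEffect_coe, oneEffect_coe, sqrt_ofReal_smul_one ht.1, smul_mul_assoc,
      one_mul, mul_smul_comm, mul_one, smul_smul]
    rw [← Complex.ofReal_mul, Real.mul_self_sqrt ht.1])

/-- The midpoint of two effects. -/
noncomputable def midEffect (A B : Effects H) : Effects H :=
  ⟨(2⁻¹ : ℂ) • ((A : H →L[ℂ] H) + B), by
    have h : (1 / 2 : ℝ) ∈ Set.Icc (0 : ℝ) 1 := by constructor <;> norm_num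
    have hA := (smulEffect _ h A).2
    have hB := (smulEffect _ h B).2
    have h1 := (smulEffect _ h (oneEffect H)).2
    have hc : ((1 / 2 : ℝ) : ℂ) = 2⁻¹ := by norm_num
    have hs : (1 : H →L[ℂ] H) = (2⁻¹ : ℂ) • 1 + (2⁻¹ : ℂ) • 1 := by
      rw [← add_smul]; norm_num
    have hA' := (smulEffect _ h (complement A)).2.1
    have hB' := (smulEffect _ h (complement B)).2.1
    simp only [smulEffect_coe, hc, complement_coe, smul_sub, sub_nonneg] at hA hB hA' hB'
    rw [smul_add]
    refine ⟨add_nonneg hA.1 hB.1, ?_⟩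
    rw [hs]
    exact add_le_add hA' hB'⟩

@[simp] theorem midEffect_coe (A B : Effects H) :
    (midEffect A B : H →L[ℂ] H) = (2⁻¹ : ℂ) • ((A : H →L[ℂ] H) + B) := rfl

theorem sqrt_of_isStarProjection {P : H →L[ℂ] H} (hP : IsStarProjection P) : CFC.sqrt P = P :=
  CFC.sqrt_unique hP.isIdempotentElem hP.nonneg

theorem seqProd_coe_of_isStarProjection {P : Effects H}
    (hP : IsStarProjection (P : H →L[ℂ] H)) (A : Effects H) :
    (seqProd P A : H →L[ℂ] H) = (P : H →L[ℂ] H) * A * P := by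
  rw [seqProd_coe, sqrt_of_isStarProjection hP]

/-- Since `P ∘ P = P²`, being a projection is a condition on `∘` alone, hence invariant under
automorphisms. -/
theorem isStarProjection_iff_seqProd_self {P : Effects H} :
    IsStarProjection (P : H →L[ℂ] H) ↔ seqProd P P = P := by
  rw [Subtype.ext_iff, seqProd_self_coe]
  exact ⟨fun h => h.isIdempotentElem, fun h => ⟨h, Effects.isSelfAdjoint P⟩⟩

/-- The projection onto the line spanned by `x`, as an effect. -/
noncomputable def lineProj (x : H) : Effects H :=
  ⟨(ℂ ∙ x).starProjection, isStarProjection_starProjection.mem_Icc⟩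

theorem lineProj_isStarProjection (x : H) : IsStarProjection (lineProj x : H →L[ℂ] H) :=
  isStarProjection_starProjection

theorem lineProj_apply (x z : H) :
    (lineProj x : H →L[ℂ] H) z = (⟪x, z⟫_ℂ / ((‖x‖ ^ 2 : ℝ) : ℂ)) • x :=
  Submodule.starProjection_singleton ℂ z

theorem lineProj_unit_apply {x : H} (hx : ‖x‖ = 1) (z : H) :
    (lineProj x : H →L[ℂ] H) z = ⟪x, z⟫_ℂ • x :=
  Submodule.starProjection_unit_singleton ℂ hx z

theorem lineProj_smul {c : ℂ} (hc : c ≠ 0) (x : H) : lineProj (c • x) = lineProj x :=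
  Subtype.ext (by
    simp only [lineProj, Submodule.span_singleton_smul_eq (IsUnit.mk0 c hc)])

theorem lineProj_apply_self (x : H) : (lineProj x : H →L[ℂ] H) x = x :=
  Submodule.starProjection_eq_self_iff.2 (Submodule.mem_span_singleton_self x)

theorem lineProj_mul_mul {x : H} (hx : ‖x‖ = 1) (A : H →L[ℂ] H) :
    (lineProj x : H →L[ℂ] H) * A * (lineProj x : H →L[ℂ] H) =
      ⟪x, A x⟫_ℂ • (lineProj x : H →L[ℂ] H) := by
  ext z
  simp [lineProj_unit_apply hx, smul_smul, mul_comm]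

theorem expectation_coe (A : Effects H) (x : H) :
    ((expectation (A : H →L[ℂ] H) x : ℝ) : ℂ) = ⟪x, (A : H →L[ℂ] H) x⟫_ℂ := by
  have h := ((ContinuousLinearMap.nonneg_iff_isPositive _).1 A.2.1).inner_nonneg_right x
  exact Complex.ext rfl (Complex.nonneg_iff.1 h).2

theorem expectation_mem {x : H} (hx : ‖x‖ = 1) (A : Effects H) :
    expectation (A : H →L[ℂ] H) x ∈ Set.Icc (0 : ℝ) 1 := by
  have h0 := expectation_mono A.2.1 x
  have h1 := expectation_mono A.2.2 x
  rw [expectation_one, hx, one_pow] at h1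
  exact ⟨by simpa [expectation] using h0, h1⟩

/-- The bridge from `∘` to numbers: compression to a line records exactly the expectation. -/
theorem lineProj_seqProd {x : H} (hx : ‖x‖ = 1) (A : Effects H) :
    seqProd (lineProj x) A =
      smulEffect (expectation (A : H →L[ℂ] H) x) (expectation_mem hx A) (lineProj x) :=
  Subtype.ext (by
    rw [seqProd_coe_of_isStarProjection (lineProj_isStarProjection x), lineProj_mul_mul hx,
      smulEffect_coe, expectation_coe])

theorem expectation_lineProj (x y : H) :
    expectation (lineProj x : H →L[ℂ] H) y = ‖⟪x, y⟫_ℂ‖ ^ 2 / ‖x‖ ^ 2 := by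
  rw [expectation, lineProj_apply, inner_smul_right, ← inner_conj_symm y x, div_mul_eq_mul_div,
    Complex.mul_conj, Complex.normSq_eq_norm_sq, ← Complex.ofReal_div, Complex.ofReal_re]

theorem Effects.ext_expectation {A B : Effects H}
    (h : ∀ x : H, ‖x‖ = 1 →
      expectation (A : H →L[ℂ] H) x = expectation (B : H →L[ℂ] H) x) : A = B := by
  refine Subtype.ext (ContinuousLinearMap.coe_injective ((ext_inner_map _ _).1 fun x => ?_))
  have key : expectation (A : H →L[ℂ] H) x = expectation (B : H →L[ℂ] H) x := by
    rcases eq_or_ne x 0 with rfl | hx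
    · simp [expectation]
    · have hu : ‖((‖x‖ : ℂ)⁻¹) • x‖ = 1 := norm_smul_inv_norm hx
      have hx' : x = (‖x‖ : ℂ) • ((‖x‖ : ℂ)⁻¹ • x) := by
        rw [smul_smul, mul_inv_cancel₀ (by simpa using hx), one_smul]
      rw [hx', expectation_smul, expectation_smul _ _ ((‖x‖ : ℂ)⁻¹ • x), h _ hu]
  change ⟪(A : H →L[ℂ] H) x, x⟫_ℂ = ⟪(B : H →L[ℂ] H) x, x⟫_ℂ
  rw [← inner_conj_symm, ← expectation_coe, key, expectation_coe, inner_conj_symm]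

/-- An effect that commutes with all effects for the sequential product is scalar. -/
theorem exists_smul_one_of_seqProd_comm {T : Effects H} {e : H} (he : ‖e‖ = 1)
    (hT : ∀ A, seqProd T A = seqProd A T) :
    ∃ t, ∃ ht : t ∈ Set.Icc (0 : ℝ) 1, T = smulEffect t ht (oneEffect H) := by
  set S : H →L[ℂ] H := CFC.sqrt (T : H →L[ℂ] H) with hS
  have hS' : IsSelfAdjoint S := IsSelfAdjoint.of_nonneg (CFC.sqrt_nonneg _)
  -- Commutation with `P_y` reads `S P_y S = ⟪y, T y⟫ P_y`. Applied to `S y`, the left side is `‖S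
  -- y‖² S y` and the right side a multiple of `y`.
  have hunit : ∀ y : H, ‖y‖ = 1 → ∃ c : ℂ, S y = c • y := by
    intro y hy
    have h := congrArg Subtype.val (hT (lineProj y))
    rw [seqProd_coe, seqProd_coe_of_isStarProjection (lineProj_isStarProjection y),
      lineProj_mul_mul hy, ← hS] at h
    have h2 := congrArg (fun F : H →L[ℂ] H => F (S y)) h
    have h3 : ⟪y, S (S y)⟫_ℂ = ((‖S y‖ ^ 2 : ℝ) : ℂ) := by
      rw [← ContinuousLinearMap.adjoint_inner_left, hS'.adjoint_eq, inner_self_eq_norm_sq_to_K]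
      simp
    simp only [mul_apply_eq_comp, smul_apply,
      lineProj_unit_apply hy, map_smul, h3, smul_smul] at h2
    by_cases h0 : S y = 0
    · exact ⟨0, by simp [h0]⟩
    · have hne : ((‖S y‖ ^ 2 : ℝ) : ℂ) ≠ 0 := by simpa using h0
      refine ⟨(((‖S y‖ ^ 2 : ℝ) : ℂ))⁻¹ * (⟪y, (T : H →L[ℂ] H) y⟫_ℂ * ⟪y, S y⟫_ℂ), ?_⟩
      rw [mul_smul, ← h2, smul_smul, inv_mul_cancel₀ hne, one_smul]
  have hall : ∀ y : H, ∃ c : ℂ, S y = c • y := by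
    intro y
    rcases eq_or_ne y 0 with rfl | hy
    · exact ⟨0, by simp⟩
    · obtain ⟨c, hc⟩ := hunit _ (norm_smul_inv_norm (𝕜 := ℂ) hy)
      refine ⟨c, ?_⟩
      have hn : (‖y‖ : ℂ) ≠ 0 := by simpa using hy
      rw [map_smul, smul_comm] at hc
      exact smul_right_injective H (inv_ne_zero hn) hc
  obtain ⟨c, hc⟩ := LinearMap.exists_eq_smul_id_of_forall_notLinearIndependent
    (f := (S : H →ₗ[ℂ] H)) (fun y hli => by
      obtain ⟨c, hc⟩ := hall y
      have := (LinearIndependent.pair_iff.1 hli) c (-1) (by simp [hc])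
      simpa using this.2)
  have hSc : S = c • 1 := by
    ext y
    exact congrArg (fun F : H →ₗ[ℂ] H => F y) hc
  have hTc : (T : H →L[ℂ] H) = (c * c) • 1 := by
    rw [← CFC.sqrt_mul_sqrt_self (T : H →L[ℂ] H) T.2.1, ← hS, hSc, smul_mul_smul_comm, mul_one]
  refine ⟨_, expectation_mem he T, Subtype.ext ?_⟩
  rw [smulEffect_coe, expectation_coe, hTc]
  simp [inner_self_eq_norm_sq_to_K, he]

end SequentialProduct

/-! ### Multiplicative functions on the unit interval -/

section MultiplicativeFunctions

variable {f : ℝ → ℝ}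

/-- Write `s = (s + t) r` and `t = (s + t)(1 - r)` with `r = s / (s + t)`, then factor out `f (s +
t)`. -/
theorem add_of_mul_of_one_sub
    (hmul : ∀ s ∈ Set.Icc (0 : ℝ) 1, ∀ t ∈ Set.Icc (0 : ℝ) 1, f (s * t) = f s * f t)
    (hsub : ∀ t ∈ Set.Icc (0 : ℝ) 1, f t + f (1 - t) = 1) (h0 : f 0 = 0) {s t : ℝ}
    (hs : 0 ≤ s) (ht : 0 ≤ t) (hst : s + t ≤ 1) : f (s + t) = f s + f t := by
  rcases (add_nonneg hs ht).eq_or_lt with h | h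
  · have hs0 : s = 0 := by linarith
    have ht0 : t = 0 := by linarith
    simp [hs0, ht0, h0]
  · have hr : s / (s + t) ∈ Set.Icc (0 : ℝ) 1 :=
      ⟨by positivity, (div_le_one h).2 (by linarith)⟩
    have hr' : 1 - s / (s + t) ∈ Set.Icc (0 : ℝ) 1 := ⟨by linarith [hr.2], by linarith [hr.1]⟩
    have e1 := hmul (s + t) ⟨h.le, hst⟩ _ hr
    have e2 := hmul (s + t) ⟨h.le, hst⟩ _ hr'
    have e3 : (s + t) * (s / (s + t)) = s := by field_simp
    have e4 : (s + t) * (1 - s / (s + t)) = t := by rw [mul_sub, e3]; ring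
    rw [e3] at e1
    rw [e4] at e2
    rw [e1, e2, ← mul_add, hsub _ hr, mul_one]

/-- A multiplicative self-map of the unit interval that commutes with `t ↦ 1 - t` is the
identity. -/
theorem eq_id_of_mul_of_one_sub (hf : ∀ t ∈ Set.Icc (0 : ℝ) 1, 0 ≤ f t)
    (hmul : ∀ s ∈ Set.Icc (0 : ℝ) 1, ∀ t ∈ Set.Icc (0 : ℝ) 1, f (s * t) = f s * f t)
    (hsub : ∀ t ∈ Set.Icc (0 : ℝ) 1, f t + f (1 - t) = 1) (h0 : f 0 = 0) {t : ℝ}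
    (ht : t ∈ Set.Icc (0 : ℝ) 1) : f t = t := by
  have h1 : f 1 = 1 := by simpa [h0] using hsub 1 (by simp)
  have hadd : ∀ s t : ℝ, 0 ≤ s → 0 ≤ t → s + t ≤ 1 → f (s + t) = f s + f t :=
    fun s t => add_of_mul_of_one_sub hmul hsub h0
  have hnat : ∀ u : ℝ, 0 ≤ u → ∀ k : ℕ, k * u ≤ 1 → f (k * u) = k * f u := by
    intro u hu k
    induction k with
    | zero => intro; simp [h0]
    | succ k ih =>
      intro hk
      push_cast at hk ⊢
      rw [add_mul, one_mul] at hk ⊢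
      rw [hadd _ _ (by positivity) hu hk, ih (by linarith), add_mul, one_mul]
  -- Additivity and `0 ≤ f` give `f t ≥ f (⌊t n⌋ / n) = ⌊t n⌋ / n > t - 1 / n`. The reverse
  -- inequality then comes from the same bound at `1 - t`.
  have hlow : ∀ t ∈ Set.Icc (0 : ℝ) 1, t ≤ f t := by
    intro t ht
    refine le_of_forall_pos_sub_le fun ε hε => ?_
    obtain ⟨n, hn⟩ := exists_nat_gt (1 / ε)
    have hn0 : (0 : ℝ) < n := lt_trans (by positivity) hn
    have hnε : 1 / (n : ℝ) ≤ ε := by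
      rw [div_le_iff₀ hn0]
      rw [div_lt_iff₀ hε] at hn
      linarith
    have hinv : f (1 / n) = 1 / n := by
      have h := hnat (1 / n) (by positivity) n (by field_simp; rfl)
      rw [mul_one_div_cancel hn0.ne', h1] at h
      field_simp
      linarith
    have hk1 : (⌊t * n⌋₊ : ℝ) ≤ t * n := Nat.floor_le (mul_nonneg ht.1 hn0.le)
    have hk2 : t * n < ⌊t * n⌋₊ + 1 := Nat.lt_floor_add_one _
    have hkt : (⌊t * n⌋₊ : ℝ) * (1 / n) ≤ t := by
      rw [mul_one_div, div_le_iff₀ hn0]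
      exact hk1
    have hk := hnat (1 / n) (by positivity) ⌊t * n⌋₊ (hkt.trans ht.2)
    rw [hinv] at hk
    have hrest := hadd ((⌊t * n⌋₊ : ℝ) * (1 / n)) (t - (⌊t * n⌋₊ : ℝ) * (1 / n)) (by positivity)
      (by linarith) (by linarith [ht.2])
    have hpos := hf (t - (⌊t * n⌋₊ : ℝ) * (1 / n))
      ⟨by linarith, by linarith [ht.2, show (0 : ℝ) ≤ (⌊t * n⌋₊ : ℝ) * (1 / n) by positivity]⟩
    rw [add_sub_cancel, hk] at hrest
    have : t < (⌊t * n⌋₊ : ℝ) * (1 / n) + 1 / n := by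
      rw [← add_one_mul, mul_one_div, lt_div_iff₀ hn0]
      exact hk2
    linarith
  have h2 := hlow (1 - t) ⟨by linarith [ht.2], by linarith [ht.1]⟩
  linarith [hlow t ht, hsub t ht]

end MultiplicativeFunctions

/-! ### Action on projections, scalars and pure states -/

section Automorphism

variable {H : Type*} [NormedAddCommGroup H] [InnerProductSpace ℂ H] [CompleteSpace H]
  {φ : Effects H → Effects H}

namespace IsSequentialAutomorphism

theorem symm (hφ : IsSequentialAutomorphism φ) :
    IsSequentialAutomorphism (Equiv.ofBijective φ hφ.1).symm := by
  refine ⟨Equiv.bijective _, fun A B => ?_⟩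
  rw [Equiv.symm_apply_eq, Equiv.ofBijective_apply, hφ.2]
  simp only [Equiv.ofBijective_apply_symm_apply φ hφ.1]

theorem map_zero (hφ : IsSequentialAutomorphism φ) : φ (zeroEffect H) = zeroEffect H := by
  obtain ⟨B, hB⟩ := hφ.1.2 (zeroEffect H)
  rw [← zero_seqProd B, hφ.2, hB, seqProd_zero, zero_seqProd]

theorem isStarProjection_map_iff (hφ : IsSequentialAutomorphism φ) {P : Effects H} :
    IsStarProjection (φ P : H →L[ℂ] H) ↔ IsStarProjection (P : H →L[ℂ] H) := by
  rw [isStarProjection_iff_seqProd_self, isStarProjection_iff_seqProd_self, ← hφ.2,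
    hφ.1.1.eq_iff]

/-- `(QP)* QP = PQP = P ∘ Q`, so the C*-identity applies. -/
theorem mul_eq_zero_of_seqProd_eq_zero {P Q : Effects H}
    (hP : IsStarProjection (P : H →L[ℂ] H)) (hQ : IsStarProjection (Q : H →L[ℂ] H))
    (h : seqProd P Q = zeroEffect H) : (Q : H →L[ℂ] H) * P = 0 := by
  rw [← CStarRing.star_mul_self_eq_zero_iff, star_mul, hP.isSelfAdjoint.star_eq,
    hQ.isSelfAdjoint.star_eq, mul_assoc, ← mul_assoc _ _ (P : H →L[ℂ] H),
    hQ.isIdempotentElem.eq, ← mul_assoc, ← seqProd_coe_of_isStarProjection hP, h, zeroEffect_coe]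

/-- Orthogonality of projections is invariant. The preimage `S` of `1 - φ P` is orthogonal to `P`,
so `(1 - P) ∘ S = S`. Applying `φ` gives `φ(1 - P) ∘ (1 - φ P) = 1 - φ P`, whose left side is `φ(1 -
P)` because that projection is orthogonal to `φ P`. -/
theorem map_complement (hφ : IsSequentialAutomorphism φ) {P : Effects H}
    (hP : IsStarProjection (P : H →L[ℂ] H)) : φ (complement P) = complement (φ P) := by
  have hP' := hφ.isStarProjection_map_iff.2 hP
  have hC : IsStarProjection (complement P : H →L[ℂ] H) := hP.one_sub
  have hC' := hφ.isStarProjection_map_iff.2 hC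
  obtain ⟨S, hS⟩ := hφ.1.2 (complement (φ P))
  have hS' : IsStarProjection (S : H →L[ℂ] H) := by
    rw [← hφ.isStarProjection_map_iff, hS]
    exact hP'.one_sub
  have h1 : (φ (complement P) : H →L[ℂ] H) * φ P = 0 := by
    refine mul_eq_zero_of_seqProd_eq_zero hP' hC' ?_
    rw [← hφ.2, ← hφ.map_zero]
    congr 1
    refine Subtype.ext ?_
    rw [seqProd_coe_of_isStarProjection hP, complement_coe, hP.mul_one_sub_self, zero_mul,
      zeroEffect_coe]
  have h2 : (S : H →L[ℂ] H) * P = 0 := by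
    refine mul_eq_zero_of_seqProd_eq_zero hP hS' (hφ.1.1 ?_)
    rw [hφ.2, hS, hφ.map_zero]
    refine Subtype.ext ?_
    rw [seqProd_coe_of_isStarProjection hP', complement_coe, hP'.mul_one_sub_self, zero_mul,
      zeroEffect_coe]
  have h2' : (P : H →L[ℂ] H) * S = 0 := by
    have := congrArg star h2
    rwa [star_mul, star_zero, hP.isSelfAdjoint.star_eq, hS'.isSelfAdjoint.star_eq] at this
  have h3 : seqProd (complement P) S = S := by
    refine Subtype.ext ?_
    rw [seqProd_coe_of_isStarProjection hC, complement_coe, sub_mul, one_mul, h2', sub_zero,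
      mul_sub, h2, mul_one, sub_zero]
  have h4 := congrArg (Subtype.val ∘ φ) h3
  rw [Function.comp_apply, Function.comp_apply, hφ.2, hS, seqProd_coe_of_isStarProjection hC',
    complement_coe, mul_sub, mul_one, h1, sub_zero, hC'.isIdempotentElem.eq] at h4
  exact Subtype.ext h4

theorem lineProj_ne_zero {x : H} (hx : ‖x‖ = 1) : lineProj x ≠ zeroEffect H := by
  intro h
  have h1 := lineProj_apply_self x
  rw [h, zeroEffect_coe, zero_apply] at h1
  simp [← h1] at hx

/-- Minimality: for a unit `y` in the range of `φ P_x`, the preimage `S` of `P_y` is a projection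
with `P_x ∘ S = S`. So `S = t P_x` with `t² = t` and `t ≠ 0`, that is, `S = P_x`. -/
theorem exists_map_lineProj (hφ : IsSequentialAutomorphism φ) {x : H} (hx : ‖x‖ = 1) :
    ∃ y : H, ‖y‖ = 1 ∧ φ (lineProj x) = lineProj y := by
  have hP := hφ.isStarProjection_map_iff.2 (lineProj_isStarProjection x)
  have hne : φ (lineProj x) ≠ zeroEffect H := by
    rw [← hφ.map_zero, hφ.1.1.ne_iff]
    exact lineProj_ne_zero hx
  obtain ⟨z, hz⟩ : ∃ z, (φ (lineProj x) : H →L[ℂ] H) z ≠ 0 := by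
    by_contra! h
    exact hne (Subtype.ext (ContinuousLinearMap.ext h))
  set y : H := ((‖(φ (lineProj x) : H →L[ℂ] H) z‖ : ℂ)⁻¹) • (φ (lineProj x) : H →L[ℂ] H) z with hy
  have hy1 : ‖y‖ = 1 := norm_smul_inv_norm hz
  have hyP : (φ (lineProj x) : H →L[ℂ] H) y = y := by
    rw [hy, map_smul, ← mul_apply_eq_comp, hP.isIdempotentElem.eq]
  have h1 : (φ (lineProj x) : H →L[ℂ] H) * (lineProj y : H →L[ℂ] H) = lineProj y := by
    ext w
    rw [mul_apply_eq_comp, lineProj_unit_apply hy1, map_smul, hyP]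
  have h2 : (lineProj y : H →L[ℂ] H) * (φ (lineProj x) : H →L[ℂ] H) = lineProj y := by
    have := congrArg star h1
    rwa [star_mul, hP.isSelfAdjoint.star_eq,
      (lineProj_isStarProjection y).isSelfAdjoint.star_eq] at this
  refine ⟨y, hy1, ?_⟩
  obtain ⟨S, hS⟩ := hφ.1.2 (lineProj y)
  have hS' : IsStarProjection (S : H →L[ℂ] H) := by
    rw [← hφ.isStarProjection_map_iff, hS]
    exact lineProj_isStarProjection y
  have h3 : seqProd (lineProj x) S = S := by
    refine hφ.1.1 (Subtype.ext ?_)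
    rw [hφ.2, hS, seqProd_coe_of_isStarProjection hP, h1, h2]
  rw [lineProj_seqProd hx] at h3
  have h4 := congrArg Subtype.val h3
  rw [smulEffect_coe] at h4
  set t := expectation (S : H →L[ℂ] H) x
  have h5 : (S : H →L[ℂ] H) x = (t : ℂ) • x := by
    rw [← h4, smul_apply, lineProj_apply_self]
  have h6 : ((t : ℂ) * t) • x = (t : ℂ) • x := by
    rw [mul_smul, ← h5, ← map_smul, ← h5, ← mul_apply_eq_comp, hS'.isIdempotentElem.eq]
  have hx0 : x ≠ 0 := by
    rintro rfl
    simp at hx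
  have h7 : (t : ℂ) * t = t := smul_left_injective ℂ hx0 h6
  by_cases ht : (t : ℂ) = 0
  · exfalso
    refine lineProj_ne_zero hy1 ?_
    rw [← hS, ← hφ.map_zero]
    congr 1
    refine Subtype.ext ?_
    rw [← h4, ht, zero_smul, zeroEffect_coe]
  · have ht1 : (t : ℂ) = 1 := by
      exact mul_left_cancel₀ ht (by rw [h7, mul_one])
    rw [← hS]
    congr 1
    refine Subtype.ext ?_
    rw [← h4, ht1, one_smul]

theorem exists_lineProj_eq_map (hφ : IsSequentialAutomorphism φ) {y : H} (hy : ‖y‖ = 1) :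
    ∃ x : H, ‖x‖ = 1 ∧ φ (lineProj x) = lineProj y := by
  obtain ⟨x, hx, h⟩ := hφ.symm.exists_map_lineProj hy
  refine ⟨x, hx, ?_⟩
  rw [← h]
  exact Equiv.ofBijective_apply_symm_apply φ hφ.1 _

/-- `t I` is `∘`-central, so its image is central too, hence scalar; and `t A = A ∘ (t I)`. -/
theorem exists_map_smul (hφ : IsSequentialAutomorphism φ) {e : H} (he : ‖e‖ = 1) :
    ∃ f : ℝ → ℝ, ∀ t, ∀ ht : t ∈ Set.Icc (0 : ℝ) 1, ∃ hft : f t ∈ Set.Icc (0 : ℝ) 1,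
      ∀ A, φ (smulEffect t ht A) = smulEffect (f t) hft (φ A) := by
  have h : ∀ t : ℝ, ∃ s : ℝ, ∀ ht : t ∈ Set.Icc (0 : ℝ) 1, ∃ hs : s ∈ Set.Icc (0 : ℝ) 1,
      ∀ A, φ (smulEffect t ht A) = smulEffect s hs (φ A) := by
    intro t
    by_cases ht : t ∈ Set.Icc (0 : ℝ) 1
    · obtain ⟨s, hs, h⟩ := exists_smul_one_of_seqProd_comm (T := φ (smulEffect t ht (oneEffect H)))
        he (fun A => by
          obtain ⟨B, rfl⟩ := hφ.1.2 A
          rw [← hφ.2, ← hφ.2, seqProd_smul_one, smul_one_seqProd])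
      refine ⟨s, fun _ => ⟨hs, fun A => ?_⟩⟩
      rw [← seqProd_smul_one, hφ.2, h, seqProd_smul_one]
    -- Outside the unit interval the value of `f` is irrelevant.
    · exact ⟨0, fun h => absurd h ht⟩
  choose f hf using h
  exact ⟨f, hf⟩

theorem smulEffect_injective {x : H} (hx : ‖x‖ = 1) {s t : ℝ} {hs : s ∈ Set.Icc (0 : ℝ) 1}
    {ht : t ∈ Set.Icc (0 : ℝ) 1}
    (h : smulEffect s hs (lineProj x) = smulEffect t ht (lineProj x)) : s = t := by
  have h1 := congrArg (fun A : Effects H => (A : H →L[ℂ] H) x) h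
  simp only [smulEffect_coe, smul_apply, lineProj_apply_self] at h1
  have hx0 : x ≠ 0 := by
    rintro rfl
    simp at hx
  exact Complex.ofReal_injective (smul_left_injective ℂ hx0 h1)

theorem expectation_complement {x : H} (hx : ‖x‖ = 1) (A : Effects H) :
    expectation (complement A : H →L[ℂ] H) x = 1 - expectation (A : H →L[ℂ] H) x := by
  have h := expectation_one x
  rw [hx, one_pow] at h
  rw [← h]
  simp [expectation]

/-- A sequential automorphism preserves expectations in the pure states. -/
theorem expectation_map (hφ : IsSequentialAutomorphism φ) (hdim : 2 ≤ Module.rank ℂ H) {x y : H}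
    (hx : ‖x‖ = 1) (hy : ‖y‖ = 1) (hxy : φ (lineProj x) = lineProj y) (A : Effects H) :
    expectation (φ A : H →L[ℂ] H) y = expectation (A : H →L[ℂ] H) x := by
  obtain ⟨f, hf⟩ := hφ.exists_map_smul hx
  have key : ∀ A : Effects H,
      expectation (φ A : H →L[ℂ] H) y = f (expectation (A : H →L[ℂ] H) x) := by
    intro A
    have h := congrArg φ (lineProj_seqProd hx A)
    obtain ⟨hft, hφt⟩ := hf _ (expectation_mem hx A)
    rw [hφ.2, hxy, lineProj_seqProd hy, hφt, hxy] at h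
    exact smulEffect_injective hy h
  obtain ⟨z, hz, hxz⟩ : ∃ z : H, ‖z‖ = 1 ∧ ⟪x, z⟫_ℂ = 0 := by
    have hne : (ℂ ∙ x) ≠ ⊤ := by
      intro h
      have h1 := rank_span_le (R := ℂ) ({x} : Set H)
      rw [h, rank_top, Cardinal.mk_singleton] at h1
      exact absurd (hdim.trans h1) (by norm_num)
    obtain ⟨w, hw, hw0⟩ := Submodule.exists_mem_ne_zero_of_ne_bot
      (mt Submodule.orthogonal_eq_bot_iff.1 hne)
    refine ⟨_, norm_smul_inv_norm (𝕜 := ℂ) hw0, ?_⟩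
    rw [inner_smul_right, Submodule.mem_orthogonal_singleton_iff_inner_right.1 hw, mul_zero]
  -- `φ` is known to respect complements only of projections, so `f t + f (1 - t) = 1` needs `t` as
  -- the expectation of one. The line of `√t x + √(1 - t) z` with `z ⊥ x` supplies it.
  have hrange : ∀ t ∈ Set.Icc (0 : ℝ) 1, ∃ P : Effects H,
      IsStarProjection (P : H →L[ℂ] H) ∧ expectation (P : H →L[ℂ] H) x = t := by
    intro t ht
    set w : H := ((Real.sqrt t : ℝ) : ℂ) • x + ((Real.sqrt (1 - t) : ℝ) : ℂ) • z with hw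
    have hxw : ⟪x, w⟫_ℂ = ((Real.sqrt t : ℝ) : ℂ) := by
      simp [hw, hxz, inner_self_eq_norm_sq_to_K, hx]
    have hwn : ‖w‖ ^ 2 = 1 := by
      have := norm_add_sq_eq_norm_sq_add_norm_sq_of_inner_eq_zero (𝕜 := ℂ)
        (((Real.sqrt t : ℝ) : ℂ) • x) (((Real.sqrt (1 - t) : ℝ) : ℂ) • z)
        (by rw [inner_smul_left, inner_smul_right, hxz, mul_zero, mul_zero])
      rw [sq, hw, this, norm_smul, norm_smul, hx, hz, mul_one, mul_one, Complex.norm_real,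
        Complex.norm_real, Real.norm_of_nonneg (Real.sqrt_nonneg _),
        Real.norm_of_nonneg (Real.sqrt_nonneg _), Real.mul_self_sqrt ht.1,
        Real.mul_self_sqrt (by linarith [ht.2])]
      ring
    refine ⟨lineProj w, lineProj_isStarProjection w, ?_⟩
    rw [expectation_lineProj, hwn, div_one, ← inner_conj_symm, hxw, RCLike.norm_conj,
      Complex.norm_real, Real.norm_of_nonneg (Real.sqrt_nonneg _), Real.sq_sqrt ht.1]
  rw [key]
  refine eq_id_of_mul_of_one_sub (fun t ht => (hf t ht).1.1) ?_ ?_ ?_ (expectation_mem hx A)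
  · intro s hs t ht
    obtain ⟨hfs, h1⟩ := hf s hs
    obtain ⟨hft, h2⟩ := hf t ht
    have hst : s * t ∈ Set.Icc (0 : ℝ) 1 := ⟨mul_nonneg hs.1 ht.1, mul_le_one₀ hs.2 ht.1 ht.2⟩
    obtain ⟨hfst, h3⟩ := hf _ hst
    have e : ∀ (s t : ℝ) (hs : s ∈ Set.Icc (0 : ℝ) 1) (ht : t ∈ Set.Icc (0 : ℝ) 1)
        (hst : s * t ∈ Set.Icc (0 : ℝ) 1) (B : Effects H),
        smulEffect s hs (smulEffect t ht B) = smulEffect (s * t) hst B := fun s t hs ht hst B =>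
      Subtype.ext (by simp only [smulEffect_coe, smul_smul, Complex.ofReal_mul])
    have h4 := congrArg φ (e s t hs ht hst (lineProj x))
    rw [h1, h2, h3, hxy, e _ _ _ _ ⟨mul_nonneg hfs.1 hft.1, mul_le_one₀ hfs.2 hft.1 hft.2⟩] at h4
    exact (smulEffect_injective hy h4).symm
  · intro t ht
    obtain ⟨P, hP, rfl⟩ := hrange t ht
    rw [← expectation_complement hx, ← key, ← key, hφ.map_complement hP,
      expectation_complement hy]
    ring
  · have h := key (zeroEffect H)
    rw [hφ.map_zero] at h
    simpa [expectation] using h.symm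

end IsSequentialAutomorphism

end Automorphism

/-! ### Maps preserving real parts and absolute imaginary parts of inner products -/

section RealIsometry

variable {E F : Type*} [NormedAddCommGroup E] [InnerProductSpace ℂ E] [NormedAddCommGroup F]
  [InnerProductSpace ℂ F] {V : E → F}

/-- The defect is real-orthogonal to every value of `V` and is itself a real combination of such
values; surjectivity is not needed. -/
theorem map_add_of_re_inner (hre : ∀ v w, (⟪V v, V w⟫_ℂ).re = (⟪v, w⟫_ℂ).re) (v w : E) :
    V (v + w) = V v + V w := by
  have h : ∀ z, (⟪V z, V (v + w) - (V v + V w)⟫_ℂ).re = 0 := fun z => by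
    simp [hre]
  rw [← sub_eq_zero, ← norm_eq_zero, ← sq_eq_zero_iff, ← inner_self_eq_norm_sq (𝕜 := ℂ)]
  change (⟪V (v + w) - (V v + V w), V (v + w) - (V v + V w)⟫_ℂ).re = 0
  rw [inner_sub_left, inner_add_left, Complex.sub_re, Complex.add_re, h, h, h]
  simp

theorem map_real_smul_of_re_inner (hre : ∀ v w, (⟪V v, V w⟫_ℂ).re = (⟪v, w⟫_ℂ).re) (r : ℝ)
    (v : E) : V ((r : ℂ) • v) = (r : ℂ) • V v := by
  have h : ∀ z, (⟪V z, V ((r : ℂ) • v) - (r : ℂ) • V v⟫_ℂ).re = 0 := fun z => by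
    simp [hre]
  rw [← sub_eq_zero, ← norm_eq_zero, ← sq_eq_zero_iff, ← inner_self_eq_norm_sq (𝕜 := ℂ)]
  change (⟪V ((r : ℂ) • v) - (r : ℂ) • V v, V ((r : ℂ) • v) - (r : ℂ) • V v⟫_ℂ).re = 0
  rw [inner_sub_left, inner_smul_left, Complex.sub_re, Complex.conj_ofReal, Complex.re_ofReal_mul,
    h, h]
  simp

/-- Equality case of Cauchy–Schwarz: `V (i v)` and `i V v` have norm `‖v‖`, and the real part of
their inner product is `±‖v‖²`. -/
theorem map_I_smul_eq_or (hre : ∀ v w, (⟪V v, V w⟫_ℂ).re = (⟪v, w⟫_ℂ).re)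
    (him : ∀ v w, |(⟪V v, V w⟫_ℂ).im| = |(⟪v, w⟫_ℂ).im|) (v : E) :
    V (Complex.I • v) = Complex.I • V v ∨ V (Complex.I • v) = -(Complex.I • V v) := by
  have hself : ∀ w, ‖V w‖ ^ 2 = ‖w‖ ^ 2 := fun w => by
    rw [← inner_self_eq_norm_sq (𝕜 := ℂ), ← inner_self_eq_norm_sq (𝕜 := ℂ)]
    exact hre w w
  have hI : ∀ w : F, ‖Complex.I • w‖ ^ 2 = ‖w‖ ^ 2 := fun w => by simp [norm_smul]
  have hI' : ∀ w : E, ‖Complex.I • w‖ ^ 2 = ‖w‖ ^ 2 := fun w => by simp [norm_smul]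
  have h1 : (⟪V (Complex.I • v), Complex.I • V v⟫_ℂ).re = -(⟪V (Complex.I • v), V v⟫_ℂ).im := by
    simp
  have h2 : (⟪Complex.I • v, v⟫_ℂ).im = -‖v‖ ^ 2 := by
    rw [inner_smul_left, inner_self_eq_norm_sq_to_K]
    simp [← Complex.ofReal_pow]
  have h3 := him (Complex.I • v) v
  rw [h2, abs_neg, abs_of_nonneg (sq_nonneg ‖v‖)] at h3
  rcases eq_or_eq_neg_of_abs_eq h3 with h | h
  · right
    rw [eq_neg_iff_add_eq_zero, ← norm_eq_zero, ← sq_eq_zero_iff, norm_add_sq (𝕜 := ℂ), hself, hI,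
      hself, hI']
    change _ + 2 * (⟪V (Complex.I • v), Complex.I • V v⟫_ℂ).re + _ = 0
    rw [h1, h]
    ring
  · left
    rw [← sub_eq_zero, ← norm_eq_zero, ← sq_eq_zero_iff, norm_sub_sq (𝕜 := ℂ), hself, hI,
      hself, hI']
    change _ - 2 * (⟪V (Complex.I • v), Complex.I • V v⟫_ℂ).re + _ = 0
    rw [h1, h]
    ring

/-- A map between complex inner product spaces that preserves the real part of the inner product
and the imaginary part up to sign is complex-linear or conjugate-linear. -/
theorem linear_or_conjLinear (hre : ∀ v w, (⟪V v, V w⟫_ℂ).re = (⟪v, w⟫_ℂ).re)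
    (him : ∀ v w, |(⟪V v, V w⟫_ℂ).im| = |(⟪v, w⟫_ℂ).im|) :
    (∀ (c : ℂ) v, V (c • v) = c • V v) ∨
      ∀ (c : ℂ) v, V (c • v) = (starRingEnd ℂ) c • V v := by
  have hdecomp : ∀ (c : ℂ) v,
      V (c • v) = (c.re : ℂ) • V v + (c.im : ℂ) • V (Complex.I • v) := by
    intro c v
    nth_rw 1 [← Complex.re_add_im c]
    rw [add_smul, mul_smul, map_add_of_re_inner hre, map_real_smul_of_re_inner hre,
      map_real_smul_of_re_inner hre]
  -- The sign does not depend on the vector: opposite signs at `v` and `w` leave none possible at `v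
  -- + w`.
  have hdich : (∀ v, V (Complex.I • v) = Complex.I • V v) ∨
      ∀ v, V (Complex.I • v) = -(Complex.I • V v) := by
    by_contra! h
    obtain ⟨⟨v, hv⟩, w, hw⟩ := h
    have hv' := (map_I_smul_eq_or hre him v).resolve_left hv
    have hw' := (map_I_smul_eq_or hre him w).resolve_right hw
    have hsum : V (Complex.I • (v + w)) = -(Complex.I • V v) + Complex.I • V w := by
      rw [smul_add, map_add_of_re_inner hre, hv', hw']
    rcases map_I_smul_eq_or hre him (v + w) with h | h
    · rw [hsum, map_add_of_re_inner hre, smul_add, add_left_inj] at h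
      exact hv (hv'.trans h)
    · rw [hsum, map_add_of_re_inner hre, smul_add, neg_add, add_right_inj] at h
      exact hw (hw'.trans h)
  rcases hdich with h | h
  · refine Or.inl fun c v => ?_
    rw [hdecomp, h, smul_smul, ← add_smul, Complex.re_add_im]
  · refine Or.inr fun c v => ?_
    rw [hdecomp, h, smul_neg, smul_smul, ← neg_smul, ← add_smul]
    congr 1
    apply Complex.ext <;> simp

end RealIsometry

/-! ### Extending a semilinear isometry across a line -/

section Extension

variable {H : Type*} [NormedAddCommGroup H] [InnerProductSpace ℂ H]
  {σ σ' : ℂ →+* ℂ} [RingHomInvPair σ σ'] [RingHomInvPair σ' σ] [RingHomIsometric σ]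

theorem norm_add_sq_of_mem_orthogonal {e v : H} (he : ‖e‖ = 1) (hv : ⟪e, v⟫_ℂ = 0) (a : ℂ) :
    ‖a • e + v‖ ^ 2 = ‖a‖ ^ 2 + ‖v‖ ^ 2 := by
  have := norm_add_sq_eq_norm_sq_add_norm_sq_of_inner_eq_zero (𝕜 := ℂ) (a • e) v
    (by rw [inner_smul_left, hv, mul_zero])
  rw [sq, this, norm_smul, he]
  ring

/-- A surjective semilinear isometry between the orthogonal complements of two unit vectors
extends to a semilinear isometry of the whole space. -/
theorem exists_extension {e e' : H} (he : ‖e‖ = 1) (he' : ‖e'‖ = 1)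
    (V : (ℂ ∙ e)ᗮ → (ℂ ∙ e')ᗮ) (hadd : ∀ v w, V (v + w) = V v + V w)
    (hsmul : ∀ (c : ℂ) v, V (c • v) = σ c • V v) (hnorm : ∀ v, ‖V v‖ = ‖v‖)
    (hsurj : Function.Surjective V) :
    ∃ U : H ≃ₛₗᵢ[σ] H, ∀ (a : ℂ) (v : (ℂ ∙ e)ᗮ), U (a • e + v) = σ a • e' + V v := by
  have hmem : ∀ x : H, x - ⟪e, x⟫_ℂ • e ∈ (ℂ ∙ e)ᗮ := fun x => by
    rw [Submodule.mem_orthogonal_singleton_iff_inner_right, inner_sub_right, inner_smul_right,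
      inner_self_eq_norm_sq_to_K, he]
    simp
  let p : H →ₗ[ℂ] (ℂ ∙ e)ᗮ :=
    { toFun := fun x => ⟨x - ⟪e, x⟫_ℂ • e, hmem x⟩
      map_add' := fun x y => Subtype.ext (by simp [add_smul]; abel)
      map_smul' := fun c x => Subtype.ext (by simp [smul_sub, smul_smul]) }
  have hp : ∀ x : H, ⟪e, x⟫_ℂ • e + (p x : H) = x := fun x => add_sub_cancel _ _
  let U₀ : H →ₛₗ[σ] H :=
    { toFun := fun x => σ ⟪e, x⟫_ℂ • e' + V (p x)
      map_add' := fun x y => by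
        rw [inner_add_right, map_add, add_smul, map_add, hadd, Submodule.coe_add]
        abel
      map_smul' := fun c x => by
        rw [inner_smul_right, map_mul, mul_smul, map_smul, hsmul, Submodule.coe_smul, smul_add] }
  have hU₀ : ∀ (a : ℂ) (v : (ℂ ∙ e)ᗮ), U₀ (a • e + v) = σ a • e' + V v := by
    intro a v
    have hv := Submodule.mem_orthogonal_singleton_iff_inner_right.1 v.2
    have h1 : ⟪e, a • e + (v : H)⟫_ℂ = a := by
      rw [inner_add_right, inner_smul_right, inner_self_eq_norm_sq_to_K, he, hv]
      simp
    have h2 : p (a • e + v) = v := Subtype.ext (by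
      change a • e + (v : H) - ⟪e, a • e + (v : H)⟫_ℂ • e = v
      rw [h1, add_sub_cancel_left])
    change σ ⟪e, a • e + (v : H)⟫_ℂ • e' + (V (p (a • e + v)) : H) = _
    rw [h1, h2]
  let U₁ : H →ₛₗᵢ[σ] H :=
    { U₀ with
      norm_map' := fun x => by
        have h1 : ‖U₀ x‖ ^ 2 = ‖x‖ ^ 2 := by
          nth_rw 2 [← hp x]
          change ‖σ ⟪e, x⟫_ℂ • e' + (V (p x) : H)‖ ^ 2 = _
          rw [norm_add_sq_of_mem_orthogonal he
            (Submodule.mem_orthogonal_singleton_iff_inner_right.1 (p x).2),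
            norm_add_sq_of_mem_orthogonal he'
            (Submodule.mem_orthogonal_singleton_iff_inner_right.1 (V (p x)).2),
            RingHomIsometric.norm_map, ← Submodule.coe_norm, ← Submodule.coe_norm, hnorm]
        exact (sq_eq_sq₀ (norm_nonneg _) (norm_nonneg _)).1 h1 }
  have hU₁ : Function.Surjective U₁ := by
    intro y
    have hmem' : y - ⟪e', y⟫_ℂ • e' ∈ (ℂ ∙ e')ᗮ := by
      rw [Submodule.mem_orthogonal_singleton_iff_inner_right, inner_sub_right, inner_smul_right,
        inner_self_eq_norm_sq_to_K, he']
      simp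
    obtain ⟨v, hv⟩ := hsurj ⟨_, hmem'⟩
    refine ⟨σ' ⟪e', y⟫_ℂ • e + v, ?_⟩
    change U₀ _ = y
    rw [hU₀, hv, RingHomInvPair.comp_apply_eq₂]
    exact add_sub_cancel _ _
  exact ⟨LinearIsometryEquiv.ofSurjective U₁ hU₁, hU₀⟩

end Extension

/-! ### Parallelogram law, polarization and order through expectations -/

section Expectation

variable {H : Type*} [NormedAddCommGroup H] [InnerProductSpace ℂ H]

theorem expectation_add_add_expectation_sub (A : H →L[ℂ] H) (x y : H) :
    expectation A (x + y) + expectation A (x - y) = 2 * (expectation A x + expectation A y) := by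
  simp only [expectation, map_add, map_sub, inner_add_left, inner_add_right, inner_sub_left,
    inner_sub_right, Complex.add_re, Complex.sub_re]
  ring

theorem norm_ne_zero_of_inner_eq_one {e x : H} (h : ⟪e, x⟫_ℂ = 1) : ‖x‖ ≠ 0 := by
  rw [norm_ne_zero_iff]
  rintro rfl
  simp at h

variable [CompleteSpace H]

theorem re_inner_eq_expectation {A : H →L[ℂ] H} (hA : IsSelfAdjoint A) (x y : H) :
    2 * (⟪y, A x⟫_ℂ).re = expectation A (x + y) - expectation A x - expectation A y := by
  have h : (⟪x, A y⟫_ℂ).re = (⟪y, A x⟫_ℂ).re := by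
    rw [← ContinuousLinearMap.adjoint_inner_left, hA.adjoint_eq, ← inner_conj_symm,
      Complex.conj_re]
  simp only [expectation, map_add, inner_add_left, inner_add_right, Complex.add_re, h]
  ring

theorem Effects.le_iff_expectation (A B : Effects H) :
    A ≤ B ↔ ∀ x, expectation (A : H →L[ℂ] H) x ≤ expectation (B : H →L[ℂ] H) x := by
  refine ⟨fun h x => expectation_mono h x, fun h => ?_⟩
  change (A : H →L[ℂ] H) ≤ B
  rw [ContinuousLinearMap.le_def, ContinuousLinearMap.isPositive_def']
  refine ⟨(Effects.isSelfAdjoint B).sub (Effects.isSelfAdjoint A), fun x => ?_⟩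
  have h1 := h x
  rw [ContinuousLinearMap.reApplyInnerSelf_apply, sub_apply, ← inner_conj_symm,
    RCLike.conj_re, inner_sub_right, map_sub]
  exact sub_nonneg.2 h1

end Expectation

/-! ### Wigner-type reconstruction of the implementing operator -/

section Wigner

variable {H : Type*} [NormedAddCommGroup H] [InnerProductSpace ℂ H] [CompleteSpace H]
  {φ : Effects H → Effects H}

theorem lineProj_normalize {x : H} (hx : ‖x‖ ≠ 0) : lineProj ((‖x‖ : ℂ)⁻¹ • x) = lineProj x :=
  lineProj_smul (inv_ne_zero (Complex.ofReal_ne_zero.2 hx)) x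

/-- The normalization against `e` removes the scalar ambiguity in choosing a vector on a line. -/
theorem eq_of_lineProj_eq {e a b : H} (ha : ⟪e, a⟫_ℂ = 1) (hb : ⟪e, b⟫_ℂ = 1)
    (h : lineProj a = lineProj b) : a = b := by
  have h1 := lineProj_apply_self b
  rw [← h, lineProj_apply] at h1
  have h2 := congrArg (fun z => ⟪e, z⟫_ℂ) h1
  simp only [inner_smul_right, ha, hb, mul_one] at h2
  rwa [h2, one_smul] at h1

theorem expectation_seqProd_self (A : Effects H) (x : H) :
    expectation (seqProd A A : H →L[ℂ] H) x = ‖(A : H →L[ℂ] H) x‖ ^ 2 := by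
  rw [seqProd_self_coe, expectation, mul_apply_eq_comp, ← ContinuousLinearMap.adjoint_inner_left,
    (Effects.isSelfAdjoint A).adjoint_eq, ← inner_self_eq_norm_sq (𝕜 := ℂ)]
  rfl

namespace IsSequentialAutomorphism

theorem expectation_map_of_norm_eq (hφ : IsSequentialAutomorphism φ)
    (hdim : 2 ≤ Module.rank ℂ H) {x y : H} (hx : ‖x‖ ≠ 0) (hxy : ‖y‖ = ‖x‖)
    (h : φ (lineProj x) = lineProj y) (A : Effects H) :
    expectation (φ A : H →L[ℂ] H) y = expectation (A : H →L[ℂ] H) x := by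
  have hy : ‖y‖ ≠ 0 := hxy ▸ hx
  have h1 := hφ.expectation_map hdim (norm_smul_inv_norm (𝕜 := ℂ) (norm_ne_zero_iff.1 hx))
    (norm_smul_inv_norm (𝕜 := ℂ) (norm_ne_zero_iff.1 hy))
    (by
      simp only [Complex.coe_algebraMap]
      rw [lineProj_normalize hx, lineProj_normalize hy, h]) A
  rw [expectation_smul, expectation_smul, hxy] at h1
  exact mul_left_cancel₀ (by simpa using hx) h1

/-- No additivity of `φ` is assumed; it comes from expectations, which are affine in the effect and
determine it. -/
theorem map_midEffect (hφ : IsSequentialAutomorphism φ) (hdim : 2 ≤ Module.rank ℂ H)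
    (A B : Effects H) : φ (midEffect A B) = midEffect (φ A) (φ B) := by
  have hmid : ∀ (A B : Effects H) (x : H), expectation (midEffect A B : H →L[ℂ] H) x =
      2⁻¹ * (expectation (A : H →L[ℂ] H) x + expectation (B : H →L[ℂ] H) x) := by
    intro A B x
    rw [← Complex.ofReal_inj, expectation_coe]
    push_cast
    rw [expectation_coe, expectation_coe, midEffect_coe, smul_apply, inner_smul_right, add_apply,
      inner_add_right]
  refine Effects.ext_expectation fun y hy => ?_
  obtain ⟨x, hx, hxy⟩ := hφ.exists_lineProj_eq_map hy
  rw [hφ.expectation_map hdim hx hy hxy, hmid, hmid, hφ.expectation_map hdim hx hy hxy,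
    hφ.expectation_map hdim hx hy hxy]

/-- For a unit `y` on the image line, the expectation of its projection in `e'` gives `|⟪e', y⟫| = 1
/ ‖x‖`, so normalizing `y` against `e'` yields norm `‖x‖`. -/
theorem exists_lift (hφ : IsSequentialAutomorphism φ) (hdim : 2 ≤ Module.rank ℂ H) {e e' x : H}
    (he : ‖e‖ = 1) (he' : ‖e'‖ = 1) (hee' : φ (lineProj e) = lineProj e') (hx : ⟪e, x⟫_ℂ = 1) :
    ∃ x' : H, ⟪e', x'⟫_ℂ = 1 ∧ ‖x'‖ = ‖x‖ ∧ φ (lineProj x) = lineProj x' := by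
  have hx0 := norm_ne_zero_of_inner_eq_one hx
  obtain ⟨y, hy, hxy⟩ := hφ.exists_map_lineProj
    (norm_smul_inv_norm (𝕜 := ℂ) (norm_ne_zero_iff.1 hx0))
  simp only [Complex.coe_algebraMap] at hxy
  rw [lineProj_normalize hx0] at hxy
  have h := hφ.expectation_map hdim he he' hee' (lineProj x)
  rw [hxy, expectation_lineProj, expectation_lineProj, hy, ← inner_conj_symm, RCLike.norm_conj,
    ← inner_conj_symm x, RCLike.norm_conj, hx, norm_one, one_pow, div_one, ← one_div_pow,
    sq_eq_sq₀ (norm_nonneg _) (by positivity)] at h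
  have hc : ⟪e', y⟫_ℂ ≠ 0 := by
    rw [← norm_ne_zero_iff, h]
    exact one_div_ne_zero hx0
  refine ⟨(⟪e', y⟫_ℂ)⁻¹ • y, ?_, ?_, ?_⟩
  · rw [inner_smul_right, inv_mul_cancel₀ hc]
  · rw [norm_smul, norm_inv, h, hy, mul_one, one_div, inv_inv]
  · rw [hxy, lineProj_smul (inv_ne_zero hc)]

section Lift

variable (hφ : IsSequentialAutomorphism φ) (hdim : 2 ≤ Module.rank ℂ H) {e e' : H}
  (he : ‖e‖ = 1) (he' : ‖e'‖ = 1) (hee' : φ (lineProj e) = lineProj e')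
  {x₁ x₂ y₁ y₂ : H} (hx₁ : ⟪e, x₁⟫_ℂ = 1) (hx₂ : ⟪e, x₂⟫_ℂ = 1)
  (hy₁ : ⟪e', y₁⟫_ℂ = 1) (hy₂ : ⟪e', y₂⟫_ℂ = 1) (hn₁ : ‖y₁‖ = ‖x₁‖) (hn₂ : ‖y₂‖ = ‖x₂‖)
  (hl₁ : φ (lineProj x₁) = lineProj y₁) (hl₂ : φ (lineProj x₂) = lineProj y₂)

include hφ hdim hx₁ hx₂ hn₁ hn₂ hl₁ hl₂

theorem norm_inner_lift : ‖⟪y₁, y₂⟫_ℂ‖ = ‖⟪x₁, x₂⟫_ℂ‖ := by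
  have hx0 := norm_ne_zero_of_inner_eq_one hx₁
  have h := hφ.expectation_map_of_norm_eq hdim (norm_ne_zero_of_inner_eq_one hx₂) hn₂ hl₂
    (lineProj x₁)
  rw [hl₁, expectation_lineProj, expectation_lineProj, hn₁,
    div_left_inj' (pow_ne_zero 2 hx0), sq_eq_sq₀ (norm_nonneg _) (norm_nonneg _)] at h
  exact h

include he he' hee' hy₁ hy₂

/-- Let `M` be the midpoint of the projections onto `x₁` and `x₂`. The expectation of `M ∘ M = M²`
in `e` is `‖M e‖²`, and `M e = (x₁ / ‖x₁‖² + x₂ / ‖x₂‖²) / 2` as `⟪xᵢ, e⟫ = 1`. Its cross term is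
the real part sought; the other terms involve only norms. -/
theorem re_inner_lift : (⟪y₁, y₂⟫_ℂ).re = (⟪x₁, x₂⟫_ℂ).re := by
  have h := hφ.expectation_map hdim he he' hee'
    (seqProd (midEffect (lineProj x₁) (lineProj x₂)) (midEffect (lineProj x₁) (lineProj x₂)))
  have hflip : ∀ a b : H, ⟪a, b⟫_ℂ = 1 → ⟪b, a⟫_ℂ = 1 := fun a b hab => by
    rw [← inner_conj_symm, hab, map_one]
  have expand : ∀ (r s : ℝ) (a b : H), ‖(r : ℂ) • a + (s : ℂ) • b‖ ^ 2 =
      r ^ 2 * ‖a‖ ^ 2 + 2 * (r * s * (⟪a, b⟫_ℂ).re) + s ^ 2 * ‖b‖ ^ 2 := by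
    intro r s a b
    rw [norm_add_sq (𝕜 := ℂ), norm_smul, norm_smul, inner_smul_left, inner_smul_right,
      Complex.conj_ofReal, mul_pow, mul_pow, Complex.norm_real, Complex.norm_real,
      Real.norm_eq_abs, Real.norm_eq_abs, sq_abs, sq_abs, ← mul_assoc, ← Complex.ofReal_mul]
    change _ + 2 * (((r * s : ℝ) : ℂ) * ⟪a, b⟫_ℂ).re + _ = _
    rw [Complex.re_ofReal_mul]
  rw [hφ.2, expectation_seqProd_self, expectation_seqProd_self, hφ.map_midEffect hdim, hl₁, hl₂,
    midEffect_coe, midEffect_coe, smul_apply, smul_apply, add_apply, add_apply, lineProj_apply,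
    lineProj_apply, lineProj_apply, lineProj_apply, hflip _ _ hx₁, hflip _ _ hx₂, hflip _ _ hy₁,
    hflip _ _ hy₂, hn₁, hn₂, ← Complex.ofReal_one, ← Complex.ofReal_div, ← Complex.ofReal_div,
    norm_smul, norm_smul, mul_pow, mul_pow] at h
  have h1 := mul_left_cancel₀ (by norm_num) h
  rw [expand, expand, hn₁, hn₂] at h1
  have hx₁0 := norm_ne_zero_of_inner_eq_one hx₁
  have hx₂0 := norm_ne_zero_of_inner_eq_one hx₂
  have h2 : 1 / ‖x₁‖ ^ 2 * (1 / ‖x₂‖ ^ 2) ≠ 0 :=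
    mul_ne_zero (one_div_ne_zero (pow_ne_zero 2 hx₁0)) (one_div_ne_zero (pow_ne_zero 2 hx₂0))
  exact mul_left_cancel₀ h2 (by linarith)

end Lift

/-- The map on the orthogonal complement of a unit vector induced by a sequential automorphism. -/
theorem exists_complement_map (hφ : IsSequentialAutomorphism φ) (hdim : 2 ≤ Module.rank ℂ H)
    {e e' : H} (he : ‖e‖ = 1) (he' : ‖e'‖ = 1) (hee' : φ (lineProj e) = lineProj e') :
    ∃ V : (ℂ ∙ e)ᗮ → (ℂ ∙ e')ᗮ, Function.Surjective V ∧
      (∀ v w, (⟪V v, V w⟫_ℂ).re = (⟪v, w⟫_ℂ).re) ∧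
      (∀ v w, |(⟪V v, V w⟫_ℂ).im| = |(⟪v, w⟫_ℂ).im|) ∧
      ∀ (v : (ℂ ∙ e)ᗮ) (A : Effects H), expectation (φ A : H →L[ℂ] H) (e' + V v) =
        expectation (A : H →L[ℂ] H) (e + v) := by
  have hin : ∀ {f : H}, ‖f‖ = 1 → ∀ v : (ℂ ∙ f)ᗮ, ⟪f, f + (v : H)⟫_ℂ = 1 := by
    intro f hf v
    rw [inner_add_right, inner_self_eq_norm_sq_to_K, hf,
      Submodule.mem_orthogonal_singleton_iff_inner_right.1 v.2]
    simp
  have hsub : ∀ {f x : H}, ‖f‖ = 1 → ⟪f, x⟫_ℂ = 1 → x - f ∈ (ℂ ∙ f)ᗮ := by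
    intro f x hf hx
    rw [Submodule.mem_orthogonal_singleton_iff_inner_right, inner_sub_right, hx,
      inner_self_eq_norm_sq_to_K, hf]
    simp
  have hexp : ∀ {f : H}, ‖f‖ = 1 → ∀ v w : (ℂ ∙ f)ᗮ,
      ⟪f + (v : H), f + (w : H)⟫_ℂ = 1 + ⟪v, w⟫_ℂ := by
    intro f hf v w
    rw [inner_add_left, hin hf, inner_add_right, ← inner_conj_symm (v : H) f,
      Submodule.mem_orthogonal_singleton_iff_inner_right.1 v.2, _root_.map_zero, zero_add]
    rfl
  have hT : ∀ v : (ℂ ∙ e)ᗮ, ∃ v' : (ℂ ∙ e')ᗮ, ‖e' + (v' : H)‖ = ‖e + (v : H)‖ ∧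
      φ (lineProj (e + (v : H))) = lineProj (e' + (v' : H)) := by
    intro v
    obtain ⟨x', hx', hn, hl⟩ := hφ.exists_lift hdim he he' hee' (hin he v)
    exact ⟨⟨_, hsub he' hx'⟩, by simpa using hn, by simpa using hl⟩
  choose V hVn hVl using hT
  have hre : ∀ v w, (⟪V v, V w⟫_ℂ).re = (⟪v, w⟫_ℂ).re := by
    intro v w
    have h := hφ.re_inner_lift hdim he he' hee' (hin he v) (hin he w) (hin he' (V v))
      (hin he' (V w)) (hVn v) (hVn w) (hVl v) (hVl w)
    rw [hexp he, hexp he'] at h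
    simpa only [Complex.add_re, add_right_inj] using h
  refine ⟨V, fun w => ?_, hre, fun v w => ?_, fun v A => ?_⟩
  -- Surjectivity: lift through the inverse automorphism, and use uniqueness of the normalized
  -- representative.
  · obtain ⟨x, hx, -, hl⟩ := hφ.symm.exists_lift hdim he' he
      (by rw [← hee']; exact Equiv.ofBijective_symm_apply_apply φ hφ.1 _) (hin he' w)
    refine ⟨⟨_, hsub he hx⟩, Subtype.ext ?_⟩
    have h1 := hVl ⟨_, hsub he hx⟩
    simp only [add_sub_cancel] at h1
    rw [← hl, Equiv.ofBijective_apply_symm_apply φ hφ.1] at h1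
    exact (add_left_cancel (eq_of_lineProj_eq (hin he' w) (hin he' _) h1)).symm
  -- `|1 + ⟪V v, V w⟫| = |1 + ⟪v, w⟫|` with equal real parts leaves equal squares of imaginary
  -- parts.
  · have h := hφ.norm_inner_lift hdim (hin he v) (hin he w) (hVn v) (hVn w) (hVl v) (hVl w)
    rw [hexp he, hexp he', ← sq_eq_sq₀ (norm_nonneg _) (norm_nonneg _), Complex.sq_norm,
      Complex.sq_norm, Complex.normSq_apply, Complex.normSq_apply] at h
    simp only [Complex.add_re, hre, Complex.add_im, Complex.one_im, zero_add,
      add_right_inj] at h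
    exact abs_eq_abs.2 (mul_self_eq_mul_self_iff.1 h)
  · exact hφ.expectation_map_of_norm_eq hdim (norm_ne_zero_of_inner_eq_one (hin he v)) (hVn v)
      (hVl v) A

/-! ### From preserved expectations to conjugation by a semilinear isometry -/

section Semilinear

variable {σ σ' : ℂ →+* ℂ} [RingHomInvPair σ σ'] [RingHomInvPair σ' σ]

theorem exists_expectation_comp_eq [RingHomIsometric σ] {e e' : H} (he : ‖e‖ = 1) (he' : ‖e'‖ = 1)
    {V : (ℂ ∙ e)ᗮ → (ℂ ∙ e')ᗮ} (hsurj : Function.Surjective V)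
    (hre : ∀ v w, (⟪V v, V w⟫_ℂ).re = (⟪v, w⟫_ℂ).re) (hsmul : ∀ (c : ℂ) v, V (c • v) = σ c • V v)
    (hexp : ∀ (v : (ℂ ∙ e)ᗮ) (A : Effects H), expectation (φ A : H →L[ℂ] H) (e' + V v) =
      expectation (A : H →L[ℂ] H) (e + v)) :
    ∃ U : H ≃ₛₗᵢ[σ] H, ∀ (A : Effects H) (x : H),
      expectation (φ A : H →L[ℂ] H) (U x) = expectation (A : H →L[ℂ] H) x := by
  have hnorm : ∀ v, ‖V v‖ = ‖v‖ := fun v => by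
    rw [← sq_eq_sq₀ (norm_nonneg _) (norm_nonneg _), ← inner_self_eq_norm_sq (𝕜 := ℂ),
      ← inner_self_eq_norm_sq (𝕜 := ℂ)]
    exact hre v v
  obtain ⟨U, hU⟩ := exists_extension he he' V (map_add_of_re_inner hre) hsmul hnorm hsurj
  refine ⟨U, fun A => ?_⟩
  have hne : ∀ (a : ℂ) (v : (ℂ ∙ e)ᗮ), a ≠ 0 → expectation (φ A : H →L[ℂ] H) (U (a • e + v)) =
      expectation (A : H →L[ℂ] H) (a • e + v) := by
    intro a v ha
    have h1 : a • e + (v : H) = a • ((1 : ℂ) • e + ((a⁻¹ • v : (ℂ ∙ e)ᗮ) : H)) := by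
      rw [smul_add, one_smul, Submodule.coe_smul, smul_smul, mul_inv_cancel₀ ha, one_smul]
    rw [h1, map_smulₛₗ, hU, expectation_smul, expectation_smul, RingHomIsometric.norm_map, map_one,
      one_smul, one_smul, hexp]
  intro x
  obtain ⟨a, v, rfl⟩ : ∃ (a : ℂ) (v : (ℂ ∙ e)ᗮ), a • e + (v : H) = x := by
    refine ⟨⟪e, x⟫_ℂ, ⟨x - ⟪e, x⟫_ℂ • e, ?_⟩, add_sub_cancel _ _⟩
    rw [Submodule.mem_orthogonal_singleton_iff_inner_right, inner_sub_right, inner_smul_right,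
      inner_self_eq_norm_sq_to_K, he]
    simp
  -- Vectors orthogonal to `e` have no normalized representative; the parallelogram law recovers
  -- their expectation from those in `v + e`, `v - e` and `e`.
  by_cases ha : a = 0
  · subst ha
    rw [zero_smul, zero_add]
    have h1 := expectation_add_add_expectation_sub (A : H →L[ℂ] H) v e
    have h2 := expectation_add_add_expectation_sub (φ A : H →L[ℂ] H) (U v) (U e)
    rw [← map_add, ← map_sub] at h2
    have h3 := hne 1 v one_ne_zero
    have h4 := hne (-1) v (neg_ne_zero.2 one_ne_zero)
    have h5 := hne 1 0 one_ne_zero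
    rw [one_smul, add_comm] at h3
    rw [neg_one_smul, neg_add_eq_sub] at h4
    rw [one_smul, Submodule.coe_zero, add_zero] at h5
    rw [h3, h4, h5] at h2
    linarith
  · exact hne a v ha

/-- Polarization of expectations controls only real parts, which suffices: by surjectivity the
defect is itself some `U y`. Working with real parts treats linear and conjugate-linear `U` alike.
-/
theorem intertwines_of_expectation {U : H ≃ₛₗᵢ[σ] H}
    (hU : ∀ (A : Effects H) (x : H),
      expectation (φ A : H →L[ℂ] H) (U x) = expectation (A : H →L[ℂ] H) x)
    (A : Effects H) (x : H) : (φ A : H →L[ℂ] H) (U x) = U ((A : H →L[ℂ] H) x) := by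
  have hre : ∀ a b : H, (⟪U a, U b⟫_ℂ).re = (⟪a, b⟫_ℂ).re := by
    intro a b
    have h1 := norm_add_sq (𝕜 := ℂ) a b
    have h2 := norm_add_sq (𝕜 := ℂ) (U a) (U b)
    rw [← map_add, LinearIsometryEquiv.norm_map, LinearIsometryEquiv.norm_map,
      LinearIsometryEquiv.norm_map] at h2
    simp only [RCLike.re_to_complex] at h1 h2
    linarith
  have h : ∀ y : H, (⟪U y, (φ A : H →L[ℂ] H) (U x) - U ((A : H →L[ℂ] H) x)⟫_ℂ).re = 0 := by
    intro y
    have h1 := re_inner_eq_expectation (Effects.isSelfAdjoint A) x y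
    have h2 := re_inner_eq_expectation (Effects.isSelfAdjoint (φ A)) (U x) (U y)
    rw [← map_add, hU, hU, hU] at h2
    rw [inner_sub_right, Complex.sub_re, hre]
    linarith
  obtain ⟨y, hy⟩ := U.surjective ((φ A : H →L[ℂ] H) (U x) - U ((A : H →L[ℂ] H) x))
  have h3 := h y
  rw [hy] at h3
  rw [← sub_eq_zero, ← norm_eq_zero, ← sq_eq_zero_iff, ← inner_self_eq_norm_sq (𝕜 := ℂ)]
  exact h3

theorem preservesOrder_of_expectation {U : H ≃ₛₗᵢ[σ] H}
    (hU : ∀ (A : Effects H) (x : H),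
      expectation (φ A : H →L[ℂ] H) (U x) = expectation (A : H →L[ℂ] H) x) :
    PreservesOrder φ := by
  intro A B
  rw [Effects.le_iff_expectation, Effects.le_iff_expectation, U.surjective.forall (p := fun y =>
    expectation (φ A : H →L[ℂ] H) y ≤ expectation (φ B : H →L[ℂ] H) y)]
  simp only [hU]

theorem preservesZeroProduct_of_expectation {U : H ≃ₛₗᵢ[σ] H}
    (hU : ∀ (A : Effects H) (x : H),
      expectation (φ A : H →L[ℂ] H) (U x) = expectation (A : H →L[ℂ] H) x) :
    PreservesZeroProduct φ := by
  intro A B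
  have h := intertwines_of_expectation hU
  constructor
  · intro h0
    ext y
    obtain ⟨x, rfl⟩ := U.surjective y
    rw [mul_apply_eq_comp, h, h, ← mul_apply_eq_comp, h0, zero_apply, zero_apply, _root_.map_zero]
  · intro h0
    ext x
    apply U.injective
    rw [mul_apply_eq_comp, ← h, ← h, ← mul_apply_eq_comp, h0, zero_apply, zero_apply, _root_.map_zero]

end Semilinear

end IsSequentialAutomorphism

end Wigner

end HilbertEffects

theorem mainTheorem2 {H : Type*} [NormedAddCommGroup H] [InnerProductSpace ℂ H] [CompleteSpace H]
    (hdim : 2 ≤ Module.rank ℂ H)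
    (φ : HilbertEffects.Effects H → HilbertEffects.Effects H)
    (hφ : HilbertEffects.IsSequentialAutomorphism φ) :
    HilbertEffects.PreservesOrder φ ∧ HilbertEffects.PreservesZeroProduct φ ∧
      ((∃ U ∈ unitary (H →L[ℂ] H), ∀ A : HilbertEffects.Effects H,
          (φ A : H →L[ℂ] H) = U * (A : H →L[ℂ] H) * star U) ∨
        (∃ U : HilbertEffects.Antiunitary H, ∀ A : HilbertEffects.Effects H,
          (φ A : H →L[ℂ] H) = HilbertEffects.Antiunitary.conj U (A : H →L[ℂ] H))) := by
  obtain ⟨z, hz⟩ : ∃ z : H, z ≠ 0 := by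
    by_contra! h
    have : Subsingleton H := ⟨fun a b => by rw [h a, h b]⟩
    rw [rank_subsingleton'] at hdim
    exact absurd hdim (by norm_num)
  have he : ‖((‖z‖ : ℂ)⁻¹) • z‖ = 1 := norm_smul_inv_norm hz
  obtain ⟨e', he', hee'⟩ := hφ.exists_map_lineProj he
  obtain ⟨V, hsurj, hre, him, hexp⟩ := hφ.exists_complement_map hdim he he' hee'
  rcases HilbertEffects.linear_or_conjLinear hre him with h | h
  · obtain ⟨U, hU⟩ := HilbertEffects.IsSequentialAutomorphism.exists_expectation_comp_eq (σ := RingHom.id ℂ) he he' hsurj hre h hexp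
    refine ⟨HilbertEffects.IsSequentialAutomorphism.preservesOrder_of_expectation hU, HilbertEffects.IsSequentialAutomorphism.preservesZeroProduct_of_expectation hU, Or.inl
      ⟨_, (Unitary.linearIsometryEquiv.symm U).2, fun A => ?_⟩⟩
    rw [Unitary.coe_symm_linearIsometryEquiv_apply, LinearIsometryEquiv.star_eq_symm]
    ext y
    obtain ⟨x, rfl⟩ := U.surjective y
    rw [HilbertEffects.IsSequentialAutomorphism.intertwines_of_expectation hU]
    simp
  · obtain ⟨U, hU⟩ := HilbertEffects.IsSequentialAutomorphism.exists_expectation_comp_eq (σ := starRingEnd ℂ) he he' hsurj hre h hexp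
    refine ⟨HilbertEffects.IsSequentialAutomorphism.preservesOrder_of_expectation hU, HilbertEffects.IsSequentialAutomorphism.preservesZeroProduct_of_expectation hU, Or.inr
      ⟨U, fun A => ?_⟩⟩
    ext y
    obtain ⟨x, rfl⟩ := U.surjective y
    rw [HilbertEffects.IsSequentialAutomorphism.intertwines_of_expectation hU, HilbertEffects.Antiunitary.conj_apply]
    congr 2
    exact (LinearIsometryEquiv.symm_apply_apply U x).symm
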